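/- Consider a network of two parallel links with finite state space $\Omega$, a prior $\mu_0$ on $\Omega$ with $\mu_0(\omega)>0$ for all $\omega$, and polynomial latency functions $\ell_{\omega,i}(f)=\sum_{d=0}^{D}\alpha_{d,\omega,i}f^d$, $i\in\{1,2\}$, with real coefficients (in particular, all nonnegative non-decreasing latencies of this form). For $r\ge 0$ let $\mathcal P(r)=\{x\in\mathbb R_{\ge 0}^2: x_1+x_2=r\}$. Let $\nu\in[0,1]$ be the fraction of participating agents and let $y\in\mathcal P(1-\nu)$ be a fixed flow of the non-participating agents. A private signaling policy is a family $\pi=(\pi_\omega)_{\omega\in\Omega}$ of Borel probability measures on $\mathcal P(\nu)$. The problem for an optimal policy with non-participant flow $y$ is $$\min_{\pi}\ \sum_{\omega,i}\mu_0(\omega)\int (x_i+y_i)\,\ell_{\omega,i}(x_i+y_i)\,d\pi_\omega(x)$$ subject to, for all $i,j\in\{1,2\}$, $$\sum_\omega\mu_0(\omega)\int\big(\ell_{\omega,j}(x_j+y_j)-\ell_{\omega,i}(x_i+y_i)\big)\,x_i\,d\pi_\omega(x)\ge 0,\qquad \sum_\omega\mu_0(\omega)\int\big(\ell_{\omega,j}(x_j+y_j)-\ell_{\omega,i}(x_i+y_i)\big)\,y_i\,d\pi_\omega(x)\ge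 0 .$$ Let $z$ be the vector of all monomials in $x_1,x_2$ of degree at most $(D+1)/2$ if $D$ is odd and $D/2+1$ if $D$ is even. There are symmetric matrices $C_\omega, A^{(i,j)}_\omega, B^{(i,j)}_\omega$ (depending on $y$) such that on $\mathcal P(\nu)$ the three integrands above (including the factor $\mu_0(\omega)$) equal $C_\omega\cdot zz^T$, $A^{(i,j)}_\omega\cdot zz^T$, $B^{(i,j)}_\omega\cdot zz^T$, where $\cdot$ is the Frobenius inner product; for any such matrices the problem is the generalized problem of moments $$\min_\pi \sum_\omega\int C_\omega\cdot zz^T\,d\pi_\omega\quad\text{s.t.}\quad \sum_\omega\int A^{(i,j)}_\omega\cdot zz^T\,d\pi_\omega\ge 0,\quad \sum_\omega\int B^{(i,j)}_\omega\cdot zz^T\,d\pi_\omega\ge 0,\quad i,j\in\{1,2\}. \qquad (\mathrm{GPM})$$ Then (GPM) is equivalent to the following semidefinite program, in the real variables $\eta_{\omega}^k$, $\omega\in\Omega$, $0\le k\le D+1$. Substituting $x_1=t$, $x_2=\nu-t$ in the three integrands gives univariate polynomials $c_\omega,a^{(i,j)}_\omega,b^{(i,j)}_\omega$ in $t$ of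 degree at most $D+1$; for such a polynomial $p=\sum_k p_kt^k$ write $\langle p,\eta_\omega\rangle=\sum_k p_k\eta_\omega^k$. The program is $$\min_\eta\ \sum_\omega\langle c_\omega,\eta_\omega\rangle\quad\text{s.t.}\quad \sum_\omega\langle a^{(i,j)}_\omega,\eta_\omega\rangle\ge 0,\quad \sum_\omega\langle b^{(i,j)}_\omega,\eta_\omega\rangle\ge 0,\quad \eta_\omega^0=1,\quad M_1(\eta_\omega)\succeq 0,\quad M_2(\eta_\omega)\succeq 0,$$ where, if $D+1=2h$, $M_1(m)=(m_{i+j})_{0\le i,j\le h}$ and $M_2(m)=(\nu m_{i+j+1}-m_{i+j+2})_{0\le i,j\le h-1}$, and, if $D+1=2h+1$, $M_1(m)=(m_{i+j+1})_{0\le i,j\le h}$ and $M_2(m)=(\nu m_{i+j}-m_{i+j+1})_{0\le i,j\le h}$. Precisely: (a) a vector $(m_0,\dots,m_{D+1})$ is the vector of moments of orders $0,\dots,D+1$ of a probability measure on $[0,\nu]$ if and only if $m_0=1$, $M_1(m)\succeq0$ and $M_2(m)\succeq 0$. (b) Mapping $\pi_\omega$ to the law $\tilde\pi_\omega$ of $x_1$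 is a bijection from policies onto families of probability measures on $[0,\nu]$, and it turns (GPM) into the problem of minimizing $\sum_\omega\int c_\omega\,d\tilde\pi_\omega$ subject to $\sum_\omega\int a^{(i,j)}_\omega\,d\tilde\pi_\omega\ge 0$ and $\sum_\omega\int b^{(i,j)}_\omega\,d\tilde\pi_\omega\ge 0$, preserving feasibility, infeasibility and cost. (c) The feasible points of the semidefinite program are exactly the moment vectors of the feasible families $\tilde\pi$; a family is feasible if and only if its moment vector is, and the costs agree. (d) Consequently the two problems have the same optimal value (in $[-\infty,+\infty]$), a policy $\pi$ is optimal for (GPM) if and only if the moment vector of $(\tilde\pi_\omega)_\omega$ is optimal for the semidefinite program, and every optimal solution of the semidefinite program is the moment vector of an optimal policy. -/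

import Mathlib

open MeasureTheory Polynomial

noncomputable section

/-! ### The information design problem on parallel links -/

/-- `𝒫_n(r)`: the vectors in `ℝ^n` with nonnegative entries of sum `r`. -/
def flowSimplex (n : ℕ) (r : ℝ) : Set (Fin n → ℝ) :=
  {x | (∀ i, 0 ≤ x i) ∧ ∑ i, x i = r}

/-- A network of `n` parallel links, with finite state space `Ω`, a prior of full support, and
polynomial latencies `ℓ_{ω,i}(f) = ∑_{d ≤ D} α_{d,ω,i} f^d`. -/
structure RoutingGame (Ω : Type*) [Fintype Ω] (n D : ℕ) where
  /-- the prior `μ₀` -/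
  prior : Ω → ℝ
  prior_pos : ∀ ω, 0 < prior ω
  prior_sum : ∑ ω, prior ω = 1
  /-- the coefficients `α_{d,ω,i}` -/
  coeff : Fin (D + 1) → Ω → Fin n → ℝ

/-- A private signaling policy: one probability distribution on `𝒫_n(ν)` for each state. -/
abbrev Policy (Ω : Type*) (n : ℕ) (ν : ℝ) : Type _ :=
  Ω → ProbabilityMeasure (flowSimplex n ν)

namespace RoutingGame

variable {Ω : Type*} [Fintype Ω] {n D : ℕ}

/-- The latency `ℓ_{ω,i}`. -/
def latency (G : RoutingGame Ω n D) (ω : Ω) (i : Fin n) (f : ℝ) : ℝ :=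
  ∑ d : Fin (D + 1), G.coeff d ω i * f ^ (d : ℕ)

/-- Contribution of state `ω` and recommended flow `x` to the expected total latency. -/
def costIntegrand (G : RoutingGame Ω n D) (y : Fin n → ℝ) (ω : Ω) (x : Fin n → ℝ) : ℝ :=
  G.prior ω * ∑ i, (x i + y i) * G.latency ω i (x i + y i)

/-- Contribution of state `ω` and recommended flow `x` to the obedience constraint `(i, j)`:
participants recommended link `i` do not gain by moving to link `j`. -/
def obedienceIntegrand (G : RoutingGame Ω n D) (y : Fin n → ℝ) (i j : Fin n) (ω : Ω)
    (x : Fin n → ℝ) : ℝ :=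
  G.prior ω * ((G.latency ω j (x j + y j) - G.latency ω i (x i + y i)) * x i)

/-- Contribution of state `ω` and recommended flow `x` to the Bayes-Nash constraint `(i, j)`:
non-participants using link `i` do not gain by moving to link `j`. -/
def nashIntegrand (G : RoutingGame Ω n D) (y : Fin n → ℝ) (i j : Fin n) (ω : Ω)
    (x : Fin n → ℝ) : ℝ :=
  G.prior ω * ((G.latency ω j (x j + y j) - G.latency ω i (x i + y i)) * y i)

end RoutingGame

/-! ### The generalized problem of moments -/

/-- Exponents of the monomials in `n` variables of total degree at most `D / 2 + 1`, which is
`(D + 1) / 2` for odd `D` and `D / 2 + 1` for even `D`. -/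
abbrev MonIndex (n D : ℕ) : Type :=
  {a : Fin n → Fin (D / 2 + 2) // ∑ i, (a i : ℕ) ≤ D / 2 + 1}

/-- The vector `z` of all these monomials, evaluated at `x`. -/
def monVec {n : ℕ} (D : ℕ) (x : Fin n → ℝ) : MonIndex n D → ℝ :=
  fun a => ∏ i, x i ^ (a.1 i : ℕ)

/-- Frobenius inner product `M · z zᵀ`, with `z` the monomial vector at `x`. -/
def gramEval {n D : ℕ} (M : Matrix (MonIndex n D) (MonIndex n D) ℝ) (x : Fin n → ℝ) : ℝ :=
  ∑ a, ∑ b, M a b * Matrix.vecMulVec (monVec D x) (monVec D x) a b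

/-- Matrix data of a generalized problem of moments over signaling policies. -/
structure MomentProblem (Ω : Type*) (n D : ℕ) where
  C : Ω → Matrix (MonIndex n D) (MonIndex n D) ℝ
  A : Fin n → Fin n → Ω → Matrix (MonIndex n D) (MonIndex n D) ℝ
  B : Fin n → Fin n → Ω → Matrix (MonIndex n D) (MonIndex n D) ℝ

namespace MomentProblem

variable {Ω : Type*} [Fintype Ω] {n D : ℕ}

/-- `P` is the information design problem of `G` with participation rate `ν` and non-participant
flow `y`: its matrices are symmetric, and on `𝒫_n(ν)` the quadratic forms in `z` are the cost, the
obedience and the Bayes-Nash integrands. -/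
structure Represents (P : MomentProblem Ω n D) (G : RoutingGame Ω n D) (ν : ℝ)
    (y : Fin n → ℝ) : Prop where
  C_symm : ∀ ω, (P.C ω).IsSymm
  A_symm : ∀ i j ω, (P.A i j ω).IsSymm
  B_symm : ∀ i j ω, (P.B i j ω).IsSymm
  cost_eq : ∀ ω, ∀ x ∈ flowSimplex n ν, gramEval (P.C ω) x = G.costIntegrand y ω x
  obedience_eq : ∀ i j ω, ∀ x ∈ flowSimplex n ν,
    gramEval (P.A i j ω) x = G.obedienceIntegrand y i j ω x
  nash_eq : ∀ i j ω, ∀ x ∈ flowSimplex n ν,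
    gramEval (P.B i j ω) x = G.nashIntegrand y i j ω x

/-- The objective `∑_ω ∫ C_ω · z zᵀ dπ_ω`. -/
def cost (P : MomentProblem Ω n D) {ν : ℝ} (π : Policy Ω n ν) : ℝ :=
  ∑ ω, ∫ x, gramEval (P.C ω) x.1 ∂(π ω : Measure (flowSimplex n ν))

/-- The policies that satisfy the obedience and the Bayes-Nash constraints. -/
def feasibleSet (P : MomentProblem Ω n D) (ν : ℝ) : Set (Policy Ω n ν) :=
  {π | (∀ i j, 0 ≤ ∑ ω, ∫ x, gramEval (P.A i j ω) x.1 ∂(π ω : Measure (flowSimplex n ν))) ∧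
    (∀ i j, 0 ≤ ∑ ω, ∫ x, gramEval (P.B i j ω) x.1 ∂(π ω : Measure (flowSimplex n ν)))}

end MomentProblem

/-! ### Optimal values and solutions of minimization problems -/

/-- Optimal value of `min f` over `S` (`⊤` if `S` is empty). -/
def optValue {X : Type*} (f : X → ℝ) (S : Set X) : EReal :=
  ⨅ x ∈ S, (f x : EReal)

/-- `x` is an optimal solution of `min f` over `S`. -/
def IsOptimal {X : Type*} (f : X → ℝ) (S : Set X) (x : X) : Prop :=
  x ∈ S ∧ ∀ x' ∈ S, f x ≤ f x'

/-! ### Semidefinite programs -/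

/-- Data of a semidefinite program in the real variables `v : V`: a linear objective, finitely many
linear equations and inequalities, and linear matrix inequalities
`∑_v x_v • lmiCoeff b v ≽ lmiRhs b` between real symmetric matrices. -/
structure SDP (V E I B : Type*) where
  obj : V → ℝ
  eqCoeff : E → V → ℝ
  eqRhs : E → ℝ
  ineqCoeff : I → V → ℝ
  ineqRhs : I → ℝ
  size : B → ℕ
  lmiCoeff : (b : B) → V → Matrix (Fin (size b)) (Fin (size b)) ℝ
  lmiRhs : (b : B) → Matrix (Fin (size b)) (Fin (size b)) ℝ
  lmiCoeff_symm : ∀ b v, (lmiCoeff b v).IsSymm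
  lmiRhs_symm : ∀ b, (lmiRhs b).IsSymm

namespace SDP

variable {V E I B : Type*} [Fintype V]

/-- The objective function. -/
def objective (S : SDP V E I B) (x : V → ℝ) : ℝ :=
  ∑ v, S.obj v * x v

/-- The feasible set. -/
def feasibleSet (S : SDP V E I B) : Set (V → ℝ) :=
  {x | (∀ e, ∑ v, S.eqCoeff e v * x v = S.eqRhs e) ∧
    (∀ i, S.ineqRhs i ≤ ∑ v, S.ineqCoeff i v * x v) ∧
    (∀ b, (∑ v, x v • S.lmiCoeff b v - S.lmiRhs b).PosSemidef)}

end SDP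

/-! ### Two links: univariate measures on `[0, ν]` -/

/-- The flow on the first link; it determines the recommended flow vector. -/
def firstFlow (ν : ℝ) (x : flowSimplex 2 ν) : Set.Icc (0 : ℝ) ν :=
  ⟨x.1 0, x.2.1 0, by
    have h := x.2.2
    have h1 := x.2.1 1
    rw [Fin.sum_univ_two] at h
    linarith⟩

theorem measurable_firstFlow (ν : ℝ) : Measurable (firstFlow ν) :=
  Measurable.subtype_mk ((measurable_pi_apply 0).comp measurable_subtype_coe)

/-- The laws of the flow on the first link under a policy, one for each state. -/
def firstLinkLaw {Ω : Type*} {ν : ℝ} (π : Policy Ω 2 ν) :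
    Ω → ProbabilityMeasure (Set.Icc (0 : ℝ) ν) :=
  fun ω => (π ω).map (measurable_firstFlow ν).aemeasurable

/-- The moments of orders `0, …, d` of a probability measure on `[0, ν]`. -/
def truncatedMoments {ν : ℝ} (d : ℕ) (ρ : ProbabilityMeasure (Set.Icc (0 : ℝ) ν)) :
    Fin (d + 1) → ℝ :=
  fun k => ∫ t, (t : ℝ) ^ (k : ℕ) ∂(ρ : Measure (Set.Icc (0 : ℝ) ν))

namespace RoutingGame

variable {Ω : Type*} [Fintype Ω] {D : ℕ}

/-- The recommended flow on each link, as a polynomial in the flow on the first link. -/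
def recFlowPoly (ν : ℝ) : Fin 2 → ℝ[X] :=
  ![X, C ν - X]

/-- The latency on link `i` in state `ω`, as a polynomial in the recommended flow on the first
link. -/
def latencyPoly (G : RoutingGame Ω 2 D) (ν : ℝ) (y : Fin 2 → ℝ) (ω : Ω) (i : Fin 2) : ℝ[X] :=
  ∑ d : Fin (D + 1), C (G.coeff d ω i) * (recFlowPoly ν i + C (y i)) ^ (d : ℕ)

/-- The cost integrand as a polynomial in the recommended flow on the first link. -/
def costPoly (G : RoutingGame Ω 2 D) (ν : ℝ) (y : Fin 2 → ℝ) (ω : Ω) : ℝ[X] :=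
  C (G.prior ω) * ∑ i, (recFlowPoly ν i + C (y i)) * G.latencyPoly ν y ω i

/-- The obedience integrand as a polynomial in the recommended flow on the first link. -/
def obediencePoly (G : RoutingGame Ω 2 D) (ν : ℝ) (y : Fin 2 → ℝ) (i j : Fin 2) (ω : Ω) : ℝ[X] :=
  C (G.prior ω) * ((G.latencyPoly ν y ω j - G.latencyPoly ν y ω i) * recFlowPoly ν i)

/-- The Bayes-Nash integrand as a polynomial in the recommended flow on the first link. -/
def nashPoly (G : RoutingGame Ω 2 D) (ν : ℝ) (y : Fin 2 → ℝ) (i j : Fin 2) (ω : Ω) : ℝ[X] :=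
  C (G.prior ω) * ((G.latencyPoly ν y ω j - G.latencyPoly ν y ω i) * C (y i))

/-- The objective of the univariate problem. -/
def uniCost (G : RoutingGame Ω 2 D) (ν : ℝ) (y : Fin 2 → ℝ)
    (ρ : Ω → ProbabilityMeasure (Set.Icc (0 : ℝ) ν)) : ℝ :=
  ∑ ω, ∫ t, (G.costPoly ν y ω).eval (t : ℝ) ∂(ρ ω : Measure (Set.Icc (0 : ℝ) ν))

/-- The feasible set of the univariate problem. -/
def uniFeasibleSet (G : RoutingGame Ω 2 D) (ν : ℝ) (y : Fin 2 → ℝ) :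
    Set (Ω → ProbabilityMeasure (Set.Icc (0 : ℝ) ν)) :=
  {ρ | (∀ i j, 0 ≤ ∑ ω, ∫ t, (G.obediencePoly ν y i j ω).eval (t : ℝ)
        ∂(ρ ω : Measure (Set.Icc (0 : ℝ) ν))) ∧
    (∀ i j, 0 ≤ ∑ ω, ∫ t, (G.nashPoly ν y i j ω).eval (t : ℝ)
        ∂(ρ ω : Measure (Set.Icc (0 : ℝ) ν)))}

end RoutingGame

/-! ### Hankel and localizing matrices, and the semidefinite program -/

/-- The coefficient matrix of the `k`-th moment in the `N × N` localizing matrix with weight `w`: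
its entry at `(i, j)` is the coefficient of `t^k` in `w(t) t^(i+j)`. -/
def localizingCoeff (w : ℝ[X]) (N k : ℕ) : Matrix (Fin N) (Fin N) ℝ :=
  Matrix.of fun i j => (w * X ^ ((i : ℕ) + (j : ℕ))).coeff k

theorem localizingCoeff_isSymm (w : ℝ[X]) (N k : ℕ) : (localizingCoeff w N k).IsSymm := by
  ext i j
  simp [localizingCoeff, Nat.add_comm]

/-- The weights of the two localizing matrices for moments of orders `0, …, d` on `[0, ν]`:
`1` and `t (ν - t)` if `d` is even, `t` and `ν - t` if `d` is odd. -/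
def locWeight (ν : ℝ) (d : ℕ) : Fin 2 → ℝ[X] :=
  if Even d then ![1, X * (C ν - X)] else ![X, C ν - X]

/-- The sizes of the two localizing matrices. -/
def locSize (d : ℕ) : Fin 2 → ℕ :=
  ![d / 2 + 1, (d + 1) / 2]

/-- The two localizing matrices of a real sequence `m_0, …, m_d`. For even `d = 2h` these are
`(m_{i+j})_{0≤i,j≤h}` and `(ν m_{i+j+1} - m_{i+j+2})_{0≤i,j≤h-1}`; for odd `d = 2h+1` they are
`(m_{i+j+1})_{0≤i,j≤h}` and `(ν m_{i+j} - m_{i+j+1})_{0≤i,j≤h}`. -/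
def localizingMatrix (ν : ℝ) {d : ℕ} (m : Fin (d + 1) → ℝ) (b : Fin 2) :
    Matrix (Fin (locSize d b)) (Fin (locSize d b)) ℝ :=
  ∑ k : Fin (d + 1), m k • localizingCoeff (locWeight ν d b) (locSize d b) k

/-- The semidefinite program. Its variables `η_{ω,k}` stand for the moments of orders
`0, …, D + 1` of the flow on the first link in each state `ω`. -/
def momentSDP {Ω : Type*} [Fintype Ω] [DecidableEq Ω] {D : ℕ} (G : RoutingGame Ω 2 D) (ν : ℝ)
    (y : Fin 2 → ℝ) :
    SDP (Ω × Fin (D + 1 + 1)) Ω ((Fin 2 × Fin 2) ⊕ (Fin 2 × Fin 2)) (Ω × Fin 2) where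
  obj v := (G.costPoly ν y v.1).coeff v.2
  eqCoeff ω v := if v = (ω, 0) then 1 else 0
  eqRhs _ := 1
  ineqCoeff c v := Sum.elim
    (fun p => (G.obediencePoly ν y p.1 p.2 v.1).coeff v.2)
    (fun p => (G.nashPoly ν y p.1 p.2 v.1).coeff v.2) c
  ineqRhs _ := 0
  size b := locSize (D + 1) b.2
  lmiCoeff b v :=
    if v.1 = b.1 then localizingCoeff (locWeight ν (D + 1) b.2) (locSize (D + 1) b.2) v.2 else 0
  lmiRhs _ := 0
  lmiCoeff_symm b v := by
    split_ifs
    · exact localizingCoeff_isSymm _ _ _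
    · exact Matrix.isSymm_zero
  lmiRhs_symm _ := Matrix.isSymm_zero

/-- The vector of all moments of orders `0, …, D + 1` of a family of univariate measures. -/
def momentVector {Ω : Type*} {ν : ℝ} (D : ℕ) (ρ : Ω → ProbabilityMeasure (Set.Icc (0 : ℝ) ν)) :
    Ω × Fin (D + 1 + 1) → ℝ :=
  fun v => truncatedMoments (D + 1) (ρ v.1) v.2

end

/-!
The law of the flow on the first link determines the policy, and both the cost and the constraints
depend on this law only through its moments of orders `0, …, D + 1`. So the generalized problem of
moments is the pullback of the semidefinite program along the map sending a policy to these moments,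
and everything reduces to showing that this map reaches every feasible point of the program.

The moment vectors of probability measures on `[0, ν]` form a compact convex set, hence a vector
with `m₀ = 1` outside it is separated from it by a polynomial that is nonnegative on `[0, ν]`. Such
a polynomial is a sum of weighted squares: subtract its minimum, divide out the factor given by a
minimum point, and induct on the degree. Nonnegativity of a functional on weighted squares says that
its two Hankel matrices are positive semidefinite. For `ν = 0` the interval is a point, weighted
squares no longer give all the nonnegative polynomials, and semidefiniteness of both matrices forces
the moments of positive order to vanish.
-/

/-! ### The Markov-Lukács theorem -/

section WeightedSquares

variable {R ι κ : Type*} [CommSemiring R]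

/-- The cone of sums of squares with multipliers in the family `w`, truncated to finite dimension:
the square multiplied by `w i` is that of a polynomial with `N i` coefficients. -/
noncomputable def weightedSquares (w : ι → R[X]) (N : ι → ℕ) : AddSubmonoid R[X] :=
  AddSubmonoid.closure {p | ∃ i, ∃ q : R[X], q.degree < N i ∧ w i * q ^ 2 = p}

variable {w : ι → R[X]} {N : ι → ℕ} {w' : κ → R[X]} {N' : κ → ℕ}

theorem mul_sq_mem_weightedSquares (i : ι) {q : R[X]} (hq : q.degree < N i) :
    w i * q ^ 2 ∈ weightedSquares w N :=
  AddSubmonoid.subset_closure ⟨i, q, hq, rfl⟩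

theorem degree_mul_lt_of_natDegree_add_le {f q : R[X]} {m n : ℕ} (hq : q.degree < m)
    (hmn : f.natDegree + m ≤ n) : (f * q).degree < n := by
  rcases eq_or_ne q 0 with rfl | hq0
  · simp
  · have hq' : q.natDegree < m := (natDegree_lt_iff_degree_lt hq0).2 hq
    exact degree_le_natDegree.trans_lt
      (by exact_mod_cast natDegree_mul_le.trans_lt (by omega : f.natDegree + q.natDegree < n))

theorem mul_mem_weightedSquares {f p : R[X]}
    (hf : ∀ i, ∃ j, ∃ g : R[X], f * w i = w' j * g ^ 2 ∧ g.natDegree + N i ≤ N' j)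
    (hp : p ∈ weightedSquares w N) : f * p ∈ weightedSquares w' N' := by
  induction hp using AddSubmonoid.closure_induction with
  | mem p hp =>
    obtain ⟨i, q, hq, rfl⟩ := hp
    obtain ⟨j, g, hfg, hdeg⟩ := hf i
    rw [← mul_assoc, hfg, mul_assoc, ← mul_pow]
    exact mul_sq_mem_weightedSquares j (degree_mul_lt_of_natDegree_add_le hq hdeg)
  | zero => simp
  | add p q _ _ hp hq => rw [mul_add]; exact add_mem hp hq

end WeightedSquares

theorem locWeight_two_mul (ν : ℝ) (h : ℕ) : locWeight ν (2 * h) = ![1, X * (C ν - X)] := by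
  simp [locWeight]

theorem locWeight_two_mul_add_one (ν : ℝ) (h : ℕ) :
    locWeight ν (2 * h + 1) = ![X, C ν - X] := by
  simp [locWeight]

theorem locSize_two_mul (h : ℕ) : locSize (2 * h) = ![h + 1, h] := by
  simp only [locSize]
  congr 2 <;> omega

theorem locSize_two_mul_add_one (h : ℕ) : locSize (2 * h + 1) = ![h + 1, h + 1] := by
  simp only [locSize]
  congr 2 <;> omega

theorem natDegree_C_sub_X (ν : ℝ) : (C ν - X : ℝ[X]).natDegree = 1 := by
  rw [← neg_sub, natDegree_neg, natDegree_X_sub_C]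

theorem natDegree_X_mul_C_sub_X (ν : ℝ) : (X * (C ν - X) : ℝ[X]).natDegree = 2 := by
  have hne : (C ν - X : ℝ[X]) ≠ 0 := ne_zero_of_natDegree_gt (natDegree_C_sub_X ν).ge
  rw [natDegree_X_mul hne, natDegree_C_sub_X]

theorem eval_locWeight_nonneg {ν : ℝ} (d : ℕ) (b : Fin 2) {t : ℝ} (ht : t ∈ Set.Icc 0 ν) :
    0 ≤ (locWeight ν d b).eval t := by
  have hν : 0 ≤ ν - t := sub_nonneg.2 ht.2
  obtain ⟨h, rfl | rfl⟩ := d.even_or_odd'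
  · rw [locWeight_two_mul]
    fin_cases b
    · simp
    · simpa using mul_nonneg ht.1 hν
  · rw [locWeight_two_mul_add_one]
    fin_cases b
    · simpa using ht.1
    · simpa using ht.2

theorem natDegree_locWeight_add_le (ν : ℝ) (d : ℕ) (b : Fin 2) :
    (locWeight ν d b).natDegree + 2 * locSize d b ≤ d + 2 := by
  obtain ⟨h, rfl | rfl⟩ := d.even_or_odd'
  · rw [locWeight_two_mul, locSize_two_mul]
    fin_cases b
    · simp [mul_add]
    · simp [natDegree_X_mul_C_sub_X, add_comm]
  · rw [locWeight_two_mul_add_one, locSize_two_mul_add_one]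
    fin_cases b
    · simp only [Fin.zero_eta, Matrix.cons_val_zero, natDegree_X]
      omega
    · simp only [Fin.mk_one, Matrix.cons_val_one, Matrix.cons_val_zero, natDegree_C_sub_X]
      omega

theorem natDegree_locWeight_mul_sq_le (ν : ℝ) (d : ℕ) (b : Fin 2) {q : ℝ[X]}
    (hq : q.degree < locSize d b) : (locWeight ν d b * q ^ 2).natDegree ≤ d := by
  rcases eq_or_ne q 0 with rfl | hq0
  · simp
  have hq' : q.natDegree < locSize d b := (natDegree_lt_iff_degree_lt hq0).2 hq
  have hmul : (locWeight ν d b * q ^ 2).natDegree ≤ (locWeight ν d b).natDegree + 2 * q.natDegree :=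
    natDegree_mul_le.trans (Nat.add_le_add_left natDegree_pow_le _)
  have hw := natDegree_locWeight_add_le ν d b
  omega

/-- The cone of the Markov-Lukács theorem: the polynomials `σ₀ + X (ν - X) σ₁` for even `d`, and
`X σ₀ + (ν - X) σ₁` for odd `d`, with `σ₀`, `σ₁` sums of squares such that both terms have degree
at most `d`. -/
noncomputable abbrev markovLukacsCone (ν : ℝ) (d : ℕ) : AddSubmonoid ℝ[X] :=
  weightedSquares (locWeight ν d) (locSize d)

theorem X_mul_mem_markovLukacsCone {ν : ℝ} {d : ℕ} {p : ℝ[X]} (hp : p ∈ markovLukacsCone ν d) :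
    X * p ∈ markovLukacsCone ν (d + 1) := by
  refine mul_mem_weightedSquares (Fin.forall_fin_two.2 ?_) hp
  obtain ⟨h, rfl | rfl⟩ := d.even_or_odd'
  · rw [locWeight_two_mul, locWeight_two_mul_add_one, locSize_two_mul, locSize_two_mul_add_one]
    exact ⟨⟨0, 1, by simp, by simp⟩, ⟨1, X, by simp; ring, by simp [add_comm]⟩⟩
  · rw [show 2 * h + 1 + 1 = 2 * (h + 1) by ring, locWeight_two_mul, locWeight_two_mul_add_one,
      locSize_two_mul, locSize_two_mul_add_one]
    exact ⟨⟨0, X, by simp; ring, by simp [add_comm]⟩, ⟨1, 1, by simp, by simp⟩⟩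

theorem C_sub_X_mul_mem_markovLukacsCone {ν : ℝ} {d : ℕ} {p : ℝ[X]}
    (hp : p ∈ markovLukacsCone ν d) : (C ν - X) * p ∈ markovLukacsCone ν (d + 1) := by
  have hdeg : (C ν - X : ℝ[X]).natDegree = 1 := natDegree_C_sub_X ν
  refine mul_mem_weightedSquares (Fin.forall_fin_two.2 ?_) hp
  obtain ⟨h, rfl | rfl⟩ := d.even_or_odd'
  · rw [locWeight_two_mul, locWeight_two_mul_add_one, locSize_two_mul, locSize_two_mul_add_one]
    exact ⟨⟨1, 1, by simp, by simp⟩, ⟨0, C ν - X, by simp; ring, by simp [hdeg, add_comm]⟩⟩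
  · rw [show 2 * h + 1 + 1 = 2 * (h + 1) by ring, locWeight_two_mul, locWeight_two_mul_add_one,
      locSize_two_mul, locSize_two_mul_add_one]
    exact ⟨⟨1, 1, by simp; ring, by simp⟩, ⟨0, C ν - X, by simp; ring, by simp [hdeg, add_comm]⟩⟩

theorem sq_mul_mem_markovLukacsCone {ν : ℝ} {d : ℕ} {p : ℝ[X]} (r : ℝ)
    (hp : p ∈ markovLukacsCone ν d) : (X - C r) ^ 2 * p ∈ markovLukacsCone ν (d + 2) := by
  have hweight : locWeight ν (d + 2) = locWeight ν d := by simp [locWeight, Nat.even_add]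
  have hsize (b : Fin 2) : 1 + locSize d b ≤ locSize (d + 2) b := by
    fin_cases b <;>
      simp only [locSize, Fin.zero_eta, Fin.mk_one, Matrix.cons_val_zero, Matrix.cons_val_one] <;>
      omega
  refine mul_mem_weightedSquares (fun b => ⟨b, X - C r, ?_, ?_⟩) hp
  · rw [hweight, mul_comm]
  · rw [natDegree_X_sub_C]
    exact hsize b

theorem C_mem_markovLukacsCone {ν : ℝ} (hν : 0 < ν) (d : ℕ) {c : ℝ} (hc : 0 ≤ c) :
    C c ∈ markovLukacsCone ν d := by
  have hmem (a : ℝ) (b : Fin 2) (hb : 0 < locSize d b) :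
      locWeight ν d b * C √a ^ 2 ∈ markovLukacsCone ν d :=
    mul_sq_mem_weightedSquares b (degree_C_le.trans_lt (by exact_mod_cast hb))
  obtain ⟨h, rfl | rfl⟩ := d.even_or_odd'
  · simpa [locWeight_two_mul, ← C_pow, Real.sq_sqrt hc] using
      hmem c 0 (by simp [locSize_two_mul])
  · have hsum := add_mem (hmem (c / ν) 0 (by simp [locSize_two_mul_add_one]))
      (hmem (c / ν) 1 (by simp [locSize_two_mul_add_one]))
    rwa [← C_pow, Real.sq_sqrt (by positivity), ← add_mul, locWeight_two_mul_add_one,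
      Matrix.cons_val_zero, Matrix.cons_val_one, Matrix.cons_val_zero, add_sub_cancel, ← C_mul,
      mul_div_cancel₀ _ hν.ne'] at hsum

theorem eval_nonneg_of_eval_mul_nonneg {a b : ℝ} (hab : a < b) {f q : ℝ[X]} (hf₀ : f ≠ 0)
    (hf : ∀ t ∈ Set.Icc a b, 0 ≤ f.eval t) (hfq : ∀ t ∈ Set.Icc a b, 0 ≤ (f * q).eval t) :
    ∀ t ∈ Set.Icc a b, 0 ≤ q.eval t := by
  have hdense : Dense {t | f.IsRoot t}ᶜ := (finite_setOfPred_isRoot hf₀).countable.dense_compl ℝ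
  have hclosed : IsClosed {t | 0 ≤ q.eval t} := isClosed_le continuous_const q.continuous
  have hsub : Set.Ioo a b ∩ {t | f.IsRoot t}ᶜ ⊆ {t | 0 ≤ q.eval t} := by
    rintro t ⟨ht, hroot⟩
    have ht' := Set.Ioo_subset_Icc_self ht
    exact nonneg_of_mul_nonneg_right (by simpa using hfq t ht') ((hf t ht').lt_of_ne' hroot)
  have hIoo : Set.Ioo a b ⊆ {t | 0 ≤ q.eval t} :=
    (hdense.open_subset_closure_inter isOpen_Ioo).trans (hclosed.closure_subset_iff.2 hsub)
  rw [← closure_Ioo hab.ne]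
  exact hclosed.closure_subset_iff.2 hIoo

theorem sq_X_sub_C_dvd_of_isLocalMin {p : ℝ[X]} {r : ℝ} (hr : IsLocalMin (fun t => p.eval t) r) :
    (X - C r) ^ 2 ∣ p - C (p.eval r) := by
  rcases eq_or_ne (p - C (p.eval r)) 0 with h0 | h0
  · rw [h0]
    exact dvd_zero _
  have hderiv : p.derivative.IsRoot r := by
    simpa [Polynomial.deriv] using hr.deriv_eq_zero
  rw [← le_rootMultiplicity_iff h0]
  exact (one_lt_rootMultiplicity_iff_isRoot h0).2 ⟨by simp, by simpa using hderiv⟩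

/-- The factor is linear for a minimum at an endpoint, and a double root for an interior one. -/
theorem exists_factor_of_isMinOn {ν r : ℝ} (hr : r ∈ Set.Icc 0 ν) {p : ℝ[X]}
    (hmin : IsMinOn (fun t => p.eval t) (Set.Icc 0 ν) r) :
    ∃ f : ℝ[X], f ∣ p - C (p.eval r) ∧ 0 < f.natDegree ∧ (∀ t ∈ Set.Icc 0 ν, 0 ≤ f.eval t) ∧
      ∀ d, ∀ q ∈ markovLukacsCone ν d, f * q ∈ markovLukacsCone ν (d + f.natDegree) := by
  have hroot : (X - C r) ∣ p - C (p.eval r) := X_sub_C_dvd_sub_C_eval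
  rcases hr.1.eq_or_lt with rfl | hr₀
  · refine ⟨X, by simpa using hroot, by simp, fun t ht => by simpa using ht.1, fun d q hq => ?_⟩
    rw [natDegree_X]
    exact X_mul_mem_markovLukacsCone hq
  rcases hr.2.eq_or_lt with rfl | hr₁
  · refine ⟨C r - X, by rwa [← neg_sub, neg_dvd], by simp [natDegree_C_sub_X],
      fun t ht => by simpa using ht.2, fun d q hq => ?_⟩
    rw [natDegree_C_sub_X]
    exact C_sub_X_mul_mem_markovLukacsCone hq
  · refine ⟨(X - C r) ^ 2, sq_X_sub_C_dvd_of_isLocalMin (hmin.isLocalMin (Icc_mem_nhds hr₀ hr₁)),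
      by simp, fun t _ => by simpa using sq_nonneg (t - r), fun d q hq => ?_⟩
    rw [natDegree_pow, natDegree_X_sub_C]
    exact sq_mul_mem_markovLukacsCone r hq

/-- The **Markov-Lukács theorem**. -/
theorem mem_markovLukacsCone_of_nonneg {ν : ℝ} (hν : 0 < ν) {d : ℕ} {p : ℝ[X]}
    (hdeg : p.natDegree ≤ d) (hp : ∀ t ∈ Set.Icc 0 ν, 0 ≤ p.eval t) :
    p ∈ markovLukacsCone ν d := by
  induction d using Nat.strong_induction_on generalizing p with
  | _ d ih =>
    obtain ⟨r, hr, hmin⟩ := isCompact_Icc.exists_isMinOn (Set.nonempty_Icc.2 hν.le)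
      (p.continuous.continuousOn (s := Set.Icc 0 ν))
    suffices hsub : p - C (p.eval r) ∈ markovLukacsCone ν d by
      simpa using add_mem hsub (C_mem_markovLukacsCone hν d (hp r hr))
    obtain ⟨f, ⟨q, hq⟩, hf_pos, hf, hf_mul⟩ := exists_factor_of_isMinOn hr hmin
    have hf₀ : f ≠ 0 := ne_zero_of_natDegree_gt hf_pos
    rcases eq_or_ne q 0 with rfl | hq₀
    · simp [hq]
    have hdeg_fq : f.natDegree + q.natDegree ≤ d := by
      rwa [← natDegree_mul hf₀ hq₀, ← hq, natDegree_sub_C]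
    have hq_nonneg : ∀ t ∈ Set.Icc 0 ν, 0 ≤ q.eval t :=
      eval_nonneg_of_eval_mul_nonneg hν hf₀ hf fun t ht => by simpa [← hq] using hmin ht
    have hq_mem := ih (d - f.natDegree) (by omega) (by omega) hq_nonneg
    rw [hq, ← Nat.sub_add_cancel (show f.natDegree ≤ d by omega)]
    exact hf_mul _ q hq_mem

theorem natDegree_le_of_mem_markovLukacsCone {ν : ℝ} {d : ℕ} {p : ℝ[X]}
    (hp : p ∈ markovLukacsCone ν d) : p.natDegree ≤ d := by
  induction hp using AddSubmonoid.closure_induction with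
  | mem p hp =>
    obtain ⟨b, q, hq, rfl⟩ := hp
    exact natDegree_locWeight_mul_sq_le ν d b hq
  | zero => simp
  | add p q _ _ hp hq => exact natDegree_add_le_of_degree_le hp hq

theorem eval_nonneg_of_mem_markovLukacsCone {ν : ℝ} {d : ℕ} {p : ℝ[X]}
    (hp : p ∈ markovLukacsCone ν d) {t : ℝ} (ht : t ∈ Set.Icc 0 ν) : 0 ≤ p.eval t := by
  induction hp using AddSubmonoid.closure_induction with
  | mem p hp =>
    obtain ⟨b, q, -, rfl⟩ := hp
    rw [eval_mul, eval_pow]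
    exact mul_nonneg (eval_locWeight_nonneg d b ht) (sq_nonneg _)
  | zero => simp
  | add p q _ _ hp hq => rw [eval_add]; exact add_nonneg hp hq

/-! ### Hankel matrices of a linear functional -/

/-- The `N × N` Hankel matrix of the functional `q ↦ L (w q)`; its quadratic form is `L (w q²)` on
the polynomials `q` with `N` coefficients. -/
noncomputable def weightedHankel {R : Type*} [CommSemiring R] (L : R[X] →ₗ[R] R) (w : R[X])
    (N : ℕ) : Matrix (Fin N) (Fin N) R :=
  Matrix.of fun i j => L (w * X ^ ((i : ℕ) + (j : ℕ)))

open scoped Matrix in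
theorem dotProduct_weightedHankel_mulVec {R : Type*} [CommSemiring R] [DecidableEq R]
    (L : R[X] →ₗ[R] R) (w : R[X]) {N : ℕ} (v : Fin N → R) :
    v ⬝ᵥ weightedHankel L w N *ᵥ v = L (w * ofFn N v ^ 2) := by
  have hterm (i j : Fin N) : w * (monomial i (v i) * monomial j (v j)) =
      (v i * v j) • (w * X ^ ((i : ℕ) + (j : ℕ))) := by
    rw [monomial_mul_monomial, ← smul_X_eq_monomial, mul_smul_comm]
  rw [ofFn_eq_sum_monomial, sq, Finset.sum_mul_sum]
  simp only [Finset.mul_sum, hterm, map_sum, map_smul, smul_eq_mul, dotProduct,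
    Matrix.mulVec, weightedHankel, Matrix.of_apply]
  exact Finset.sum_congr rfl fun i _ => Finset.sum_congr rfl fun j _ => by ring

section RealFunctional

variable {L : ℝ[X] →ₗ[ℝ] ℝ}

theorem posSemidef_weightedHankel_iff {w : ℝ[X]} {N : ℕ} :
    (weightedHankel L w N).PosSemidef ↔ ∀ q : ℝ[X], q.degree < N → 0 ≤ L (w * q ^ 2) := by
  refine ⟨fun h q hq => ?_, fun h => .of_dotProduct_mulVec_nonneg ?_ fun v => ?_⟩
  · rcases eq_or_ne q 0 with rfl | hq₀
    · simp
    have hform := h.dotProduct_mulVec_nonneg (toFn N q)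
    rwa [star_trivial, dotProduct_weightedHankel_mulVec,
      ofFn_comp_toFn_eq_id_of_natDegree_lt ((natDegree_lt_iff_degree_lt hq₀).2 hq)] at hform
  · ext i j
    simp [weightedHankel, add_comm]
  · rw [star_trivial, dotProduct_weightedHankel_mulVec]
    exact h _ (ofFn_degree_lt v)

open scoped MatrixOrder in
theorem map_mul_X_pow_eq_zero {w : ℝ[X]} {N k : ℕ} (hk : k + 2 ≤ 2 * N)
    (h : ∀ q : ℝ[X], q.degree < N → L (w * q ^ 2) = 0) : L (w * X ^ k) = 0 := by
  have hpos : 0 ≤ weightedHankel L w N :=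
    Matrix.nonneg_iff_posSemidef.2 (posSemidef_weightedHankel_iff.2 fun q hq => (h q hq).ge)
  have hneg : 0 ≤ -weightedHankel L w N := by
    have hmap : -weightedHankel L w N = weightedHankel L (-w) N := by
      ext i j
      simp [weightedHankel]
    rw [hmap]
    exact Matrix.nonneg_iff_posSemidef.2 (posSemidef_weightedHankel_iff.2 fun q hq => by
      rw [neg_mul, map_neg, h q hq, neg_zero])
  have hzero : weightedHankel L w N = 0 := le_antisymm (neg_nonneg.1 hneg) hpos
  obtain ⟨i, j, rfl⟩ : ∃ i j : Fin N, k = i + j :=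
    ⟨⟨min k (N - 1), by omega⟩, ⟨k - min k (N - 1), by omega⟩, by simp⟩
  exact congrFun (congrFun hzero i) j

theorem forall_mem_weightedSquares_nonneg_iff {ι : Type*} {w : ι → ℝ[X]} {N : ι → ℕ} :
    (∀ p ∈ weightedSquares w N, 0 ≤ L p) ↔ ∀ i, (weightedHankel L (w i) (N i)).PosSemidef := by
  simp only [posSemidef_weightedHankel_iff]
  refine ⟨fun h i q hq => h _ (mul_sq_mem_weightedSquares i hq), fun h p hp => ?_⟩
  induction hp using AddSubmonoid.closure_induction with
  | mem p hp =>
    obtain ⟨i, q, hq, rfl⟩ := hp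
    exact h i q hq
  | zero => simp
  | add p q _ _ hp hq => rw [map_add]; exact add_nonneg hp hq

theorem map_X_eq_zero_of_map_X_sq_eq_zero (hL : ∀ q : ℝ[X], q.degree < (2 : ℕ) → 0 ≤ L (q ^ 2))
    (hsq : L (X ^ 2) = 0) : L X = 0 := by
  by_contra hX
  have hquad (a : ℝ) : 0 ≤ L 1 - 2 * a * L X := by
    have h := hL (1 - C a * X) (by compute_degree!)
    rwa [show (1 - C a * X) ^ 2 = 1 - (2 * a) • X + a ^ 2 • X ^ 2 by
      simp only [smul_eq_C_mul, C_mul, C_pow, map_ofNat]; ring, map_add, map_sub, map_smul,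
      map_smul, hsq, smul_zero, add_zero, smul_eq_mul] at h
  have h := hquad ((L 1 + 1) / (2 * L X))
  rw [show 2 * ((L 1 + 1) / (2 * L X)) * L X = L 1 + 1 by field_simp] at h
  linarith

/-- For `ν = 0` the two weights are opposite to each other up to a square. -/
theorem map_X_pow_eq_zero_of_forall_mem_markovLukacsCone {d k : ℕ} (hk : k ≠ 0) (hkd : k ≤ d)
    (hL : ∀ p ∈ markovLukacsCone 0 d, 0 ≤ L p) : L (X ^ k) = 0 := by
  have hgen (b : Fin 2) (q : ℝ[X]) (hq : q.degree < locSize d b) :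
      0 ≤ L (locWeight 0 d b * q ^ 2) := hL _ (mul_sq_mem_weightedSquares b hq)
  obtain ⟨h, rfl | rfl⟩ := d.even_or_odd'
  · simp only [locWeight_two_mul, locSize_two_mul, Fin.forall_fin_two, Matrix.cons_val_zero,
      Matrix.cons_val_one, one_mul, C_0, zero_sub, mul_neg, neg_mul, map_neg, ← sq,
      Left.nonneg_neg_iff] at hgen
    obtain ⟨hone, hsq⟩ := hgen
    have hpow {j : ℕ} (hj : j + 2 ≤ 2 * h) : L (X ^ 2 * X ^ j) = 0 :=
      map_mul_X_pow_eq_zero hj fun q hq => le_antisymm (hsq q hq) <| by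
        rw [← mul_pow]
        exact hone _ (degree_mul_lt_of_natDegree_add_le hq (by simp [add_comm]))
    obtain rfl | hk2 : k = 1 ∨ 2 ≤ k := by omega
    · rw [pow_one]
      refine map_X_eq_zero_of_map_X_sq_eq_zero (fun q hq => hone q (hq.trans_le ?_)) ?_
      · exact_mod_cast (by omega : 2 ≤ h + 1)
      · simpa using hpow (j := 0) (by omega)
    · rw [← Nat.add_sub_cancel' hk2, pow_add]
      exact hpow (by omega)
  · simp only [locWeight_two_mul_add_one, locSize_two_mul_add_one, Fin.forall_fin_two,
      Matrix.cons_val_zero, Matrix.cons_val_one, C_0, zero_sub, neg_mul, map_neg,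
      Left.nonneg_neg_iff] at hgen
    obtain ⟨hX, hnegX⟩ := hgen
    rw [← Nat.sub_add_cancel (Nat.one_le_iff_ne_zero.2 hk), pow_succ']
    exact map_mul_X_pow_eq_zero (by omega) fun q hq => le_antisymm (hnegX q hq) (hX q hq)

end RealFunctional

/-! ### The truncated Hausdorff moment problem -/

/-- The Riesz functional of a finite sequence `m`, which sends `∑ pₖ Xᵏ` to `∑ pₖ mₖ`; it ignores
the coefficients of order at least `N`. -/
noncomputable def rieszFunctional {R : Type*} [CommSemiring R] {N : ℕ} (m : Fin N → R) :
    R[X] →ₗ[R] R :=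
  ∑ k : Fin N, m k • lcoeff R k

section RieszFunctional

variable {R : Type*} [CommSemiring R] {N : ℕ}

theorem rieszFunctional_apply (m : Fin N → R) (p : R[X]) :
    rieszFunctional m p = ∑ k : Fin N, m k * p.coeff k := by
  simp [rieszFunctional]

theorem rieszFunctional_X_pow (m : Fin N → R) (k : Fin N) :
    rieszFunctional m (X ^ (k : ℕ)) = m k := by
  simp [rieszFunctional_apply, coeff_X_pow, Fin.val_inj]

theorem rieszFunctional_C (m : Fin (N + 1) → R) (a : R) : rieszFunctional m (C a) = a * m 0 := by
  rw [← mul_one (C a), ← smul_eq_C_mul, map_smul, smul_eq_mul, ← rieszFunctional_X_pow m 0,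
    Fin.val_zero, pow_zero]

theorem rieszFunctional_ofFn [DecidableEq R] (f : (Fin N → R) →ₗ[R] R) (m : Fin N → R) :
    rieszFunctional m (ofFn N fun k => f (Pi.single k 1)) = f m := by
  have hsingle (k : Fin N) : (fun j => if k = j then 1 else 0 : Fin N → R) = Pi.single k 1 := by
    ext j
    simp [Pi.single_apply, eq_comm]
  simp [rieszFunctional_apply, f.pi_apply_eq_sum_univ m, hsingle]

end RieszFunctional

theorem localizingMatrix_eq_weightedHankel (ν : ℝ) {d : ℕ} (m : Fin (d + 1) → ℝ) (b : Fin 2) :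
    localizingMatrix ν m b =
      weightedHankel (rieszFunctional m) (locWeight ν d b) (locSize d b) := by
  ext i j
  simp [localizingMatrix, localizingCoeff, weightedHankel, rieszFunctional_apply,
    Matrix.sum_apply]

theorem forall_posSemidef_localizingMatrix_iff {ν : ℝ} {d : ℕ} {m : Fin (d + 1) → ℝ} :
    (∀ b, (localizingMatrix ν m b).PosSemidef) ↔
      ∀ p ∈ markovLukacsCone ν d, 0 ≤ rieszFunctional m p := by
  simp only [localizingMatrix_eq_weightedHankel, forall_mem_weightedSquares_nonneg_iff]

theorem integrable_eval {s : Set ℝ} [CompactSpace s] (μ : Measure s) [IsFiniteMeasure μ]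
    (p : ℝ[X]) : Integrable (fun t : s => p.eval (t : ℝ)) μ :=
  (p.continuous.comp continuous_subtype_val).integrable_of_hasCompactSupport
    (HasCompactSupport.of_compactSpace _)

section TruncatedMoments

variable {ν : ℝ} {d : ℕ}

theorem rieszFunctional_truncatedMoments (ρ : ProbabilityMeasure (Set.Icc (0 : ℝ) ν)) {p : ℝ[X]}
    (hp : p.natDegree ≤ d) :
    rieszFunctional (truncatedMoments d ρ) p =
      ∫ t, p.eval (t : ℝ) ∂(ρ : Measure (Set.Icc (0 : ℝ) ν)) := by
  simp only [eval_eq_sum_range' (Nat.lt_succ_of_le hp), Finset.sum_range]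
  rw [integral_finsetSum _ fun k _ => by
    simpa using (integrable_eval (ρ : Measure (Set.Icc (0 : ℝ) ν)) (X ^ (k : ℕ))).const_mul _]
  simp only [rieszFunctional_apply, truncatedMoments, integral_const_mul]
  exact Finset.sum_congr rfl fun k _ => mul_comm _ _

theorem truncatedMoments_zero (ρ : ProbabilityMeasure (Set.Icc (0 : ℝ) ν)) :
    truncatedMoments d ρ 0 = 1 := by
  simp [truncatedMoments]

theorem truncatedMoments_diracProba (t : Set.Icc (0 : ℝ) ν) (k : Fin (d + 1)) :
    truncatedMoments d (diracProba t) k = (t : ℝ) ^ (k : ℕ) :=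
  integral_dirac _ _

theorem continuous_truncatedMoments : Continuous (truncatedMoments (ν := ν) d) :=
  continuous_pi fun k => ProbabilityMeasure.continuous_integral_boundedContinuousFunction
    (BoundedContinuousFunction.mkOfCompact
      ⟨fun t : Set.Icc (0 : ℝ) ν => (t : ℝ) ^ (k : ℕ), by fun_prop⟩)

theorem convex_range_truncatedMoments : Convex ℝ (Set.range (truncatedMoments (ν := ν) d)) := by
  rintro _ ⟨ρ, rfl⟩ _ ⟨σ, rfl⟩ a b ha hb hab
  have hprob : IsProbabilityMeasure (ENNReal.ofReal a • (ρ : Measure (Set.Icc (0 : ℝ) ν)) +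
      ENNReal.ofReal b • (σ : Measure (Set.Icc (0 : ℝ) ν))) :=
    ⟨by simp [← ENNReal.ofReal_add ha hb, hab]⟩
  have hint (τ : ProbabilityMeasure (Set.Icc (0 : ℝ) ν)) (c : ℝ) (k : ℕ) :
      Integrable (fun t : Set.Icc (0 : ℝ) ν => (t : ℝ) ^ k)
        (ENNReal.ofReal c • (τ : Measure (Set.Icc (0 : ℝ) ν))) := by
    simpa using (integrable_eval _ (X ^ k)).smul_measure ENNReal.ofReal_ne_top
  refine ⟨⟨_, hprob⟩, funext fun k => ?_⟩
  simp [truncatedMoments, integral_add_measure (hint ρ a k) (hint σ b k), ENNReal.toReal_ofReal, ha,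
    hb]

/-- A truncated form of the **Riesz-Haviland theorem**. -/
theorem mem_range_truncatedMoments {m : Fin (d + 1) → ℝ} (hm : m 0 = 1)
    (h : ∀ p : ℝ[X], p.natDegree ≤ d → (∀ t ∈ Set.Icc 0 ν, 0 ≤ p.eval t) →
      0 ≤ rieszFunctional m p) : m ∈ Set.range (truncatedMoments (ν := ν) d) := by
  by_contra hmem
  obtain ⟨f, u, hfm, hf⟩ := geometric_hahn_banach_point_closed convex_range_truncatedMoments
    (isCompact_range continuous_truncatedMoments).isClosed hmem
  set p : ℝ[X] := ofFn (d + 1) fun k => f (Pi.single k 1)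
  have hpf (x : Fin (d + 1) → ℝ) : rieszFunctional x p = f x :=
    rieszFunctional_ofFn f.toLinearMap x
  have hdeg : p.natDegree ≤ d := Nat.lt_succ_iff.1 (ofFn_natDegree_lt (by omega) _)
  have hnonneg : ∀ t ∈ Set.Icc 0 ν, 0 ≤ (p - C u).eval t := fun t ht => by
    have hdirac := hf _ ⟨diracProba ⟨t, ht⟩, rfl⟩
    rw [← hpf, rieszFunctional_truncatedMoments _ hdeg, diracProba, ProbabilityMeasure.coe_mk,
      integral_dirac] at hdirac
    simpa using hdirac.le
  have hsep := h (p - C u) (by rwa [natDegree_sub_C]) hnonneg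
  rw [map_sub, hpf, rieszFunctional_C, hm] at hsep
  linarith

theorem truncatedMoments_diracProba_zero_eq {m : Fin (d + 1) → ℝ} (hm : m 0 = 1)
    (h : ∀ p ∈ markovLukacsCone 0 d, 0 ≤ rieszFunctional m p) :
    truncatedMoments d (diracProba (⟨0, Set.left_mem_Icc.2 le_rfl⟩ : Set.Icc (0 : ℝ) 0)) = m := by
  ext k
  rcases eq_or_ne k 0 with rfl | hk
  · rw [truncatedMoments_zero, hm]
  · have hk₀ : (k : ℕ) ≠ 0 := Fin.val_ne_zero_iff.2 hk
    rw [← rieszFunctional_X_pow m k,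
      map_X_pow_eq_zero_of_forall_mem_markovLukacsCone hk₀ (Nat.lt_succ_iff.1 k.2) h]
    simp [truncatedMoments_diracProba, hk₀]

theorem posSemidef_localizingMatrix_truncatedMoments (ρ : ProbabilityMeasure (Set.Icc (0 : ℝ) ν)) :
    ∀ b, (localizingMatrix ν (truncatedMoments d ρ) b).PosSemidef := by
  refine forall_posSemidef_localizingMatrix_iff.2 fun p hp => ?_
  rw [rieszFunctional_truncatedMoments ρ (natDegree_le_of_mem_markovLukacsCone hp)]
  exact integral_nonneg fun t => eval_nonneg_of_mem_markovLukacsCone hp t.2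

/-- The **truncated Hausdorff moment problem**. -/
theorem exists_truncatedMoments_eq_iff (hν : 0 ≤ ν) (m : Fin (d + 1) → ℝ) :
    (∃ ρ : ProbabilityMeasure (Set.Icc (0 : ℝ) ν), truncatedMoments d ρ = m) ↔
      m 0 = 1 ∧ ∀ b, (localizingMatrix ν m b).PosSemidef := by
  constructor
  · rintro ⟨ρ, rfl⟩
    exact ⟨truncatedMoments_zero ρ, posSemidef_localizingMatrix_truncatedMoments ρ⟩
  · rintro ⟨hm, h⟩
    rw [forall_posSemidef_localizingMatrix_iff] at h
    rcases hν.eq_or_lt with rfl | hν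
    · exact ⟨_, truncatedMoments_diracProba_zero_eq hm h⟩
    · exact mem_range_truncatedMoments hm fun p hdeg hp =>
        h p (mem_markovLukacsCone_of_nonneg hν hdeg hp)

end TruncatedMoments

/-! ### Polynomials in one coordinate as Gram forms -/

section GramEval

variable {n D : ℕ}

theorem gramEval_zero (x : Fin n → ℝ) :
    gramEval (0 : Matrix (MonIndex n D) (MonIndex n D) ℝ) x = 0 := by
  simp [gramEval]

theorem gramEval_add (M N : Matrix (MonIndex n D) (MonIndex n D) ℝ) (x : Fin n → ℝ) :
    gramEval (M + N) x = gramEval M x + gramEval N x := by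
  simp [gramEval, add_mul, Finset.sum_add_distrib]

theorem gramEval_smul (c : ℝ) (M : Matrix (MonIndex n D) (MonIndex n D) ℝ) (x : Fin n → ℝ) :
    gramEval (c • M) x = c * gramEval M x := by
  simp [gramEval, Finset.mul_sum, mul_assoc]

theorem gramEval_single (a b : MonIndex n D) (x : Fin n → ℝ) :
    gramEval (Matrix.single a b 1) x = monVec D x a * monVec D x b := by
  simp [gramEval, Matrix.single_apply, ite_and, Matrix.vecMulVec_apply]

/-- The exponent of the monomial `xᵢ ^ k`. -/
def powIndex (i : Fin n) (k : Fin (D / 2 + 2)) : MonIndex n D :=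
  ⟨Pi.single i k, by
    rw [Finset.sum_eq_single i (fun j _ hj => by simp [hj]) (by simp), Pi.single_eq_same]
    omega⟩

theorem monVec_powIndex (i : Fin n) (k : Fin (D / 2 + 2)) (x : Fin n → ℝ) :
    monVec D x (powIndex i k) = x i ^ (k : ℕ) := by
  rw [monVec, Finset.prod_eq_single i (fun j _ hj => by simp [powIndex, hj]) (by simp)]
  simp [powIndex]

theorem exists_gramEval_eq_pow (i : Fin n) {k : ℕ} (hk : k ≤ 2 * (D / 2 + 1)) :
    ∃ M : Matrix (MonIndex n D) (MonIndex n D) ℝ, M.IsSymm ∧ ∀ x, gramEval M x = x i ^ k := by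
  obtain ⟨a, b, rfl⟩ : ∃ a b : Fin (D / 2 + 2), k = a + b :=
    ⟨⟨min k (D / 2 + 1), by omega⟩, ⟨k - min k (D / 2 + 1), by omega⟩, by simp⟩
  let E := Matrix.single (powIndex i a) (powIndex i b) (1 : ℝ)
  refine ⟨(1 / 2 : ℝ) • (E + E.transpose), (Matrix.isSymm_add_transpose_self E).smul _,
    fun x => ?_⟩
  rw [gramEval_smul, gramEval_add, Matrix.transpose_single, gramEval_single, gramEval_single,
    monVec_powIndex, monVec_powIndex]
  ring

theorem exists_gramEval_eq_eval (i : Fin n) {p : ℝ[X]} (hp : p.natDegree ≤ 2 * (D / 2 + 1)) :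
    ∃ M : Matrix (MonIndex n D) (MonIndex n D) ℝ, M.IsSymm ∧ ∀ x, gramEval M x = p.eval (x i) := by
  refine induction_with_natDegree_le
    (fun p => ∃ M : Matrix (MonIndex n D) (MonIndex n D) ℝ,
      M.IsSymm ∧ ∀ x, gramEval M x = p.eval (x i)) _
    ⟨0, Matrix.isSymm_zero, fun x => by rw [gramEval_zero, eval_zero]⟩ ?_ ?_ p hp
  · intro k c _ hk
    obtain ⟨M, hM, hMk⟩ := exists_gramEval_eq_pow i hk
    exact ⟨c • M, hM.smul c, fun x => by simp [gramEval_smul, hMk]⟩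
  · rintro p q - - ⟨M, hM, hMp⟩ ⟨N, hN, hNq⟩
    exact ⟨M + N, hM.add hN, fun x => by rw [gramEval_add, hMp, hNq, eval_add]⟩

end GramEval

/-! ### The integrands as polynomials in the flow on the first link -/

namespace RoutingGame

variable {Ω : Type*} [Fintype Ω] {D : ℕ} (G : RoutingGame Ω 2 D)

section NatDegree

variable (ν : ℝ) (y : Fin 2 → ℝ)

theorem natDegree_recFlowPoly (i : Fin 2) : (recFlowPoly ν i).natDegree = 1 := by
  fin_cases i
  · exact natDegree_X
  · exact natDegree_C_sub_X ν

theorem natDegree_latencyPoly_le (ω : Ω) (i : Fin 2) : (G.latencyPoly ν y ω i).natDegree ≤ D := by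
  refine natDegree_sum_le_of_forall_le _ _ fun d _ => (natDegree_C_mul_le _ _).trans ?_
  rw [natDegree_pow, natDegree_add_C, natDegree_recFlowPoly, mul_one]
  exact Nat.lt_succ_iff.1 d.2

theorem natDegree_latencyPoly_sub_le (ω : Ω) (i j : Fin 2) :
    (G.latencyPoly ν y ω j - G.latencyPoly ν y ω i).natDegree ≤ D :=
  (natDegree_sub_le _ _).trans <|
    max_le (G.natDegree_latencyPoly_le ν y ω j) (G.natDegree_latencyPoly_le ν y ω i)

theorem natDegree_costPoly_le (ω : Ω) : (G.costPoly ν y ω).natDegree ≤ D + 1 := by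
  refine (natDegree_C_mul_le _ _).trans (natDegree_sum_le_of_forall_le _ _ fun i _ => ?_)
  rw [add_comm D]
  exact natDegree_mul_le_of_le (natDegree_add_C.trans_le (natDegree_recFlowPoly ν i).le)
    (G.natDegree_latencyPoly_le ν y ω i)

theorem natDegree_obediencePoly_le (i j : Fin 2) (ω : Ω) :
    (G.obediencePoly ν y i j ω).natDegree ≤ D + 1 :=
  (natDegree_C_mul_le _ _).trans <| natDegree_mul_le_of_le
    (G.natDegree_latencyPoly_sub_le ν y ω i j) (natDegree_recFlowPoly ν i).le

theorem natDegree_nashPoly_le (i j : Fin 2) (ω : Ω) : (G.nashPoly ν y i j ω).natDegree ≤ D + 1 :=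
  (natDegree_C_mul_le _ _).trans <| (natDegree_mul_C_le _ _).trans <|
    (G.natDegree_latencyPoly_sub_le ν y ω i j).trans (Nat.le_succ D)

end NatDegree

section Eval

variable {ν : ℝ} {x : Fin 2 → ℝ} (y : Fin 2 → ℝ)

theorem eval_recFlowPoly (hx : x ∈ flowSimplex 2 ν) (i : Fin 2) :
    (recFlowPoly ν i).eval (x 0) = x i := by
  have hsum := hx.2
  rw [Fin.sum_univ_two] at hsum
  fin_cases i
  · simp [recFlowPoly]
  · simp [recFlowPoly, ← hsum]

theorem eval_latencyPoly (hx : x ∈ flowSimplex 2 ν) (ω : Ω) (i : Fin 2) :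
    (G.latencyPoly ν y ω i).eval (x 0) = G.latency ω i (x i + y i) := by
  simp [latencyPoly, latency, eval_finsetSum, eval_recFlowPoly hx]

theorem eval_costPoly (hx : x ∈ flowSimplex 2 ν) (ω : Ω) :
    (G.costPoly ν y ω).eval (x 0) = G.costIntegrand y ω x := by
  simp only [costPoly, costIntegrand, eval_mul, eval_C, eval_finsetSum, eval_add,
    eval_recFlowPoly hx, G.eval_latencyPoly y hx]

theorem eval_obediencePoly (hx : x ∈ flowSimplex 2 ν) (i j : Fin 2) (ω : Ω) :
    (G.obediencePoly ν y i j ω).eval (x 0) = G.obedienceIntegrand y i j ω x := by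
  simp only [obediencePoly, obedienceIntegrand, eval_mul, eval_C, eval_sub,
    eval_recFlowPoly hx, G.eval_latencyPoly y hx]

theorem eval_nashPoly (hx : x ∈ flowSimplex 2 ν) (i j : Fin 2) (ω : Ω) :
    (G.nashPoly ν y i j ω).eval (x 0) = G.nashIntegrand y i j ω x := by
  simp only [nashPoly, nashIntegrand, eval_mul, eval_C, eval_sub, G.eval_latencyPoly y hx]

end Eval

theorem exists_represents (ν : ℝ) (y : Fin 2 → ℝ) :
    ∃ P : MomentProblem Ω 2 D, P.Represents G ν y := by
  have hgram {p : ℝ[X]} (hp : p.natDegree ≤ D + 1) :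
      ∃ M : Matrix (MonIndex 2 D) (MonIndex 2 D) ℝ,
        M.IsSymm ∧ ∀ x, gramEval M x = p.eval (x 0) :=
    exists_gramEval_eq_eval 0 (hp.trans (by omega))
  choose C hC hC_eval using fun ω => hgram (G.natDegree_costPoly_le ν y ω)
  choose A hA hA_eval using fun i j ω => hgram (G.natDegree_obediencePoly_le ν y i j ω)
  choose B hB hB_eval using fun i j ω => hgram (G.natDegree_nashPoly_le ν y i j ω)
  exact ⟨⟨C, A, B⟩, hC, hA, hB, fun ω x hx => (hC_eval ω x).trans (G.eval_costPoly y hx ω),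
    fun i j ω x hx => (hA_eval i j ω x).trans (G.eval_obediencePoly y hx i j ω),
    fun i j ω x hx => (hB_eval i j ω x).trans (G.eval_nashPoly y hx i j ω)⟩

end RoutingGame

/-! ### Reduction to the first link -/

theorem bijective_map_measurableEquiv {α β : Type*} [MeasurableSpace α] [MeasurableSpace β]
    (e : α ≃ᵐ β) :
    Function.Bijective fun μ : ProbabilityMeasure α => μ.map e.measurable.aemeasurable :=
  Function.bijective_iff_has_inverse.2 ⟨fun μ => μ.map e.symm.measurable.aemeasurable,
    fun _ => Subtype.ext e.map_symm_map, fun _ => Subtype.ext e.map_map_symm⟩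

/-- The correspondence between flow vectors of value `ν` on two links and flows on the first
link. -/
def firstFlowEquiv (ν : ℝ) : flowSimplex 2 ν ≃ᵐ Set.Icc (0 : ℝ) ν where
  toFun := firstFlow ν
  invFun t := ⟨![t, ν - t], Fin.forall_fin_two.2 ⟨t.2.1, sub_nonneg.2 t.2.2⟩, by simp⟩
  left_inv x := Subtype.ext <| funext <| Fin.forall_fin_two.2 <| by
    have hsum := x.2.2
    rw [Fin.sum_univ_two] at hsum
    exact ⟨rfl, sub_eq_of_eq_add' hsum.symm⟩
  right_inv _ := rfl
  measurable_toFun := measurable_firstFlow ν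
  measurable_invFun := Measurable.subtype_mk <| measurable_pi_iff.2 <| Fin.forall_fin_two.2
    ⟨measurable_subtype_coe, measurable_const.sub measurable_subtype_coe⟩

theorem bijective_firstLinkLaw (Ω : Type*) (ν : ℝ) :
    Function.Bijective (firstLinkLaw : Policy Ω 2 ν → _) :=
  Function.Bijective.piMap fun _ => bijective_map_measurableEquiv (firstFlowEquiv ν)

theorem integral_gramEval_eq_integral_eval {ν : ℝ} {D : ℕ}
    {M : Matrix (MonIndex 2 D) (MonIndex 2 D) ℝ} {p : ℝ[X]}
    (hMp : ∀ x ∈ flowSimplex 2 ν, gramEval M x = p.eval (x 0))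
    (μ : ProbabilityMeasure (flowSimplex 2 ν)) :
    ∫ x, gramEval M x.1 ∂(μ : Measure (flowSimplex 2 ν)) =
      ∫ t, p.eval (t : ℝ) ∂(μ.map (measurable_firstFlow ν).aemeasurable : Measure (Set.Icc 0 ν)) :=
  calc ∫ x, gramEval M x.1 ∂(μ : Measure (flowSimplex 2 ν))
    _ = ∫ x, p.eval (firstFlow ν x : ℝ) ∂(μ : Measure (flowSimplex 2 ν)) :=
        integral_congr_ae (.of_forall fun x => hMp x.1 x.2)
    _ = _ := (integral_map_equiv (firstFlowEquiv ν) fun t => p.eval (t : ℝ)).symm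

namespace MomentProblem.Represents

variable {Ω : Type*} [Fintype Ω] {D : ℕ} {P : MomentProblem Ω 2 D} {G : RoutingGame Ω 2 D} {ν : ℝ}
  {y : Fin 2 → ℝ}

theorem feasibleSet_eq_preimage (hP : P.Represents G ν y) :
    P.feasibleSet ν = firstLinkLaw ⁻¹' G.uniFeasibleSet ν y := by
  have hA (i j : Fin 2) (ω : Ω) := integral_gramEval_eq_integral_eval fun x hx =>
    (hP.obedience_eq i j ω x hx).trans (G.eval_obediencePoly y hx i j ω).symm
  have hB (i j : Fin 2) (ω : Ω) := integral_gramEval_eq_integral_eval fun x hx =>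
    (hP.nash_eq i j ω x hx).trans (G.eval_nashPoly y hx i j ω).symm
  ext π
  simp only [MomentProblem.feasibleSet, RoutingGame.uniFeasibleSet, firstLinkLaw,
    Set.mem_preimage, Set.mem_ofPred_eq, hA, hB]

theorem cost_eq_comp (hP : P.Represents G ν y) :
    (P.cost : Policy Ω 2 ν → ℝ) = G.uniCost ν y ∘ firstLinkLaw :=
  funext fun π => Finset.sum_congr rfl fun ω _ => integral_gramEval_eq_integral_eval
    (fun x hx => (hP.cost_eq ω x hx).trans (G.eval_costPoly y hx ω).symm) (π ω)

end MomentProblem.Represents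

/-! ### The semidefinite program -/

section MomentSDP

variable {Ω : Type*} [Fintype Ω] {D : ℕ} (G : RoutingGame Ω 2 D) (ν : ℝ) (y : Fin 2 → ℝ)

theorem sum_coeff_mul_eq_sum_rieszFunctional {N : ℕ} (p : Ω → ℝ[X]) (η : Ω × Fin N → ℝ) :
    ∑ v, (p v.1).coeff v.2 * η v = ∑ ω, rieszFunctional (fun k => η (ω, k)) (p ω) := by
  simp only [Fintype.sum_prod_type, rieszFunctional_apply, mul_comm]

theorem sum_integral_eval_eq_sum_coeff_mul {p : Ω → ℝ[X]} (hp : ∀ ω, (p ω).natDegree ≤ D + 1)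
    (ρ : Ω → ProbabilityMeasure (Set.Icc (0 : ℝ) ν)) :
    ∑ ω, ∫ t, (p ω).eval (t : ℝ) ∂(ρ ω : Measure (Set.Icc (0 : ℝ) ν)) =
      ∑ v, (p v.1).coeff v.2 * momentVector D ρ v := by
  rw [sum_coeff_mul_eq_sum_rieszFunctional]
  exact Finset.sum_congr rfl fun ω _ => (rieszFunctional_truncatedMoments (ρ ω) (hp ω)).symm

variable [DecidableEq Ω]

theorem sum_smul_ite_localizingCoeff (η : Ω × Fin (D + 1 + 1) → ℝ) (b : Ω × Fin 2) :
    ∑ v, η v • (if v.1 = b.1 then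
        localizingCoeff (locWeight ν (D + 1) b.2) (locSize (D + 1) b.2) v.2 else 0) =
      localizingMatrix ν (fun k => η (b.1, k)) b.2 := by
  rw [Fintype.sum_prod_type, localizingMatrix,
    Finset.sum_eq_single b.1 (fun ω _ hω => by simp [hω]) (by simp)]
  simp

theorem mem_feasibleSet_momentSDP_iff (η : Ω × Fin (D + 1 + 1) → ℝ) :
    η ∈ (momentSDP G ν y).feasibleSet ↔
      (∀ ω, η (ω, 0) = 1 ∧ ∀ b, (localizingMatrix ν (fun k => η (ω, k)) b).PosSemidef) ∧
      (∀ i j, 0 ≤ ∑ v, (G.obediencePoly ν y i j v.1).coeff v.2 * η v) ∧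
      (∀ i j, 0 ≤ ∑ v, (G.nashPoly ν y i j v.1).coeff v.2 * η v) := by
  have hlmi (b : Ω × Fin 2) :
      ∑ v, η v • (momentSDP G ν y).lmiCoeff b v - (momentSDP G ν y).lmiRhs b =
        localizingMatrix ν (fun k => η (b.1, k)) b.2 :=
    (sub_zero _).trans (sum_smul_ite_localizingCoeff ν η b)
  have heq (ω : Ω) : ∑ v, (momentSDP G ν y).eqCoeff ω v * η v = η (ω, 0) := by
    simp [momentSDP]
  rw [SDP.feasibleSet, Set.mem_ofPred_eq]
  simp only [hlmi, heq]
  rw [forall_and, Prod.forall, Sum.forall, Prod.forall, Prod.forall]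
  exact ⟨fun ⟨h₁, h₂, h₃⟩ => ⟨⟨h₁, h₃⟩, h₂⟩, fun ⟨⟨h₁, h₃⟩, h₂⟩ => ⟨h₁, h₂, h₃⟩⟩

theorem uniFeasibleSet_eq_preimage :
    G.uniFeasibleSet ν y = momentVector D ⁻¹' (momentSDP G ν y).feasibleSet := by
  ext ρ
  have hmoments (ω : Ω) : momentVector D ρ (ω, 0) = 1 ∧
      ∀ b, (localizingMatrix ν (fun k => momentVector D ρ (ω, k)) b).PosSemidef :=
    ⟨truncatedMoments_zero (ρ ω), posSemidef_localizingMatrix_truncatedMoments (ρ ω)⟩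
  rw [Set.mem_preimage, mem_feasibleSet_momentSDP_iff, and_iff_right hmoments]
  simp only [RoutingGame.uniFeasibleSet, Set.mem_ofPred_eq,
    sum_integral_eval_eq_sum_coeff_mul ν (G.natDegree_obediencePoly_le ν y _ _),
    sum_integral_eval_eq_sum_coeff_mul ν (G.natDegree_nashPoly_le ν y _ _)]

theorem uniCost_eq_comp :
    G.uniCost ν y = (momentSDP G ν y).objective ∘ momentVector D :=
  funext <| sum_integral_eval_eq_sum_coeff_mul ν (G.natDegree_costPoly_le ν y)

theorem feasibleSet_momentSDP_subset_range {ν : ℝ} (hν : 0 ≤ ν) :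
    (momentSDP G ν y).feasibleSet ⊆ Set.range (momentVector (ν := ν) D) := by
  intro η hη
  choose ρ hρ using fun ω => (exists_truncatedMoments_eq_iff hν fun k => η (ω, k)).2
    (((mem_feasibleSet_momentSDP_iff G ν y η).1 hη).1 ω)
  exact ⟨ρ, funext fun v => congrFun (hρ v.1) v.2⟩

end MomentSDP

/-! ### Minimization problems that are pulled back along a map -/

section Pullback

variable {X Y : Type*} {Φ : X → Y} {T : Set Y}

theorem optValue_comp_preimage (hT : T ⊆ Set.range Φ) (g : Y → ℝ) :
    optValue (g ∘ Φ) (Φ ⁻¹' T) = optValue g T := by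
  conv_rhs => rw [← Set.image_preimage_eq_of_subset hT]
  simp only [optValue, iInf_image, Function.comp_apply]

theorem isOptimal_comp_preimage_iff (hT : T ⊆ Set.range Φ) (g : Y → ℝ) (x : X) :
    IsOptimal (g ∘ Φ) (Φ ⁻¹' T) x ↔ IsOptimal g T (Φ x) := by
  refine and_congr_right fun _ => ?_
  conv_rhs => rw [← Set.image_preimage_eq_of_subset hT]
  rw [Set.forall_mem_image]
  rfl

theorem exists_isOptimal_comp_preimage (hT : T ⊆ Set.range Φ) {g : Y → ℝ} {y : Y}
    (hy : IsOptimal g T y) :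
    ∃ x, IsOptimal (g ∘ Φ) (Φ ⁻¹' T) x ∧ Φ x = y := by
  obtain ⟨x, rfl⟩ := hT hy.1
  exact ⟨x, (isOptimal_comp_preimage_iff hT g x).2 hy, rfl⟩

end Pullback

theorem proposition1_general {Ω : Type*} [Fintype Ω] [DecidableEq Ω] {D : ℕ}
    (G : RoutingGame Ω 2 D) (ν : ℝ) (hν : 0 ≤ ν) (y : Fin 2 → ℝ) :
    (∃ P : MomentProblem Ω 2 D, P.Represents G ν y) ∧
    (∀ m : Fin (D + 1 + 1) → ℝ,
      (∃ ρ : ProbabilityMeasure (Set.Icc (0 : ℝ) ν), truncatedMoments (D + 1) ρ = m) ↔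
        m 0 = 1 ∧ ∀ b, (localizingMatrix ν m b).PosSemidef) ∧
    ∀ P : MomentProblem Ω 2 D, P.Represents G ν y →
      Function.Bijective (firstLinkLaw : Policy Ω 2 ν → _) ∧
      (∀ π : Policy Ω 2 ν,
        (π ∈ P.feasibleSet ν ↔ firstLinkLaw π ∈ G.uniFeasibleSet ν y) ∧
        P.cost π = G.uniCost ν y (firstLinkLaw π)) ∧
      (momentSDP G ν y).feasibleSet = momentVector D '' G.uniFeasibleSet ν y ∧
      (∀ ρ : Ω → ProbabilityMeasure (Set.Icc (0 : ℝ) ν),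
        (ρ ∈ G.uniFeasibleSet ν y ↔ momentVector D ρ ∈ (momentSDP G ν y).feasibleSet) ∧
        G.uniCost ν y ρ = (momentSDP G ν y).objective (momentVector D ρ)) ∧
      optValue P.cost (P.feasibleSet ν) =
        optValue (momentSDP G ν y).objective (momentSDP G ν y).feasibleSet ∧
      (∀ π : Policy Ω 2 ν, IsOptimal P.cost (P.feasibleSet ν) π ↔
        IsOptimal (momentSDP G ν y).objective (momentSDP G ν y).feasibleSet
          (momentVector D (firstLinkLaw π))) ∧
      (∀ η, IsOptimal (momentSDP G ν y).objective (momentSDP G ν y).feasibleSet η →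
        ∃ π : Policy Ω 2 ν, IsOptimal P.cost (P.feasibleSet ν) π ∧
          momentVector D (firstLinkLaw π) = η) := by
  refine ⟨G.exists_represents ν y, exists_truncatedMoments_eq_iff hν, fun P hP => ?_⟩
  have hbij := bijective_firstLinkLaw Ω ν
  have hrange_uni := feasibleSet_momentSDP_subset_range G y hν
  have huni := uniFeasibleSet_eq_preimage G ν y
  have hfeas : P.feasibleSet ν =
      (momentVector D ∘ firstLinkLaw) ⁻¹' (momentSDP G ν y).feasibleSet := by
    rw [hP.feasibleSet_eq_preimage, huni, Set.preimage_comp]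
  have hcost : (P.cost : Policy Ω 2 ν → ℝ) =
      (momentSDP G ν y).objective ∘ (momentVector D ∘ firstLinkLaw) := by
    rw [hP.cost_eq_comp, uniCost_eq_comp, Function.comp_assoc]
  have hrange : (momentSDP G ν y).feasibleSet ⊆
      Set.range (momentVector D ∘ (firstLinkLaw : Policy Ω 2 ν → _)) := by
    rwa [hbij.surjective.range_comp]
  refine ⟨hbij, fun π => ⟨Set.ext_iff.1 hP.feasibleSet_eq_preimage π, congrFun hP.cost_eq_comp π⟩,
    ?_, fun ρ => ⟨Set.ext_iff.1 huni ρ, congrFun (uniCost_eq_comp G ν y) ρ⟩, ?_⟩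
  · rw [huni, Set.image_preimage_eq_of_subset hrange_uni]
  · rw [hfeas, hcost]
    exact ⟨optValue_comp_preimage hrange _, isOptimal_comp_preimage_iff hrange _,
      fun _ => exists_isOptimal_comp_preimage hrange⟩

theorem proposition1 {Ω : Type*} [Fintype Ω] [DecidableEq Ω] {D : ℕ} (G : RoutingGame Ω 2 D)
    (ν : ℝ) (hν : ν ∈ Set.Icc (0 : ℝ) 1) (y : Fin 2 → ℝ) (hy : y ∈ flowSimplex 2 (1 - ν)) :
    -- the problem can be written as a generalized problem of moments
    (∃ P : MomentProblem Ω 2 D, P.Represents G ν y) ∧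
    -- univariate truncated moment sequences on `[0, ν]`
    (∀ m : Fin (D + 1 + 1) → ℝ,
      (∃ ρ : ProbabilityMeasure (Set.Icc (0 : ℝ) ν), truncatedMoments (D + 1) ρ = m) ↔
        m 0 = 1 ∧ ∀ b, (localizingMatrix ν m b).PosSemidef) ∧
    ∀ P : MomentProblem Ω 2 D, P.Represents G ν y →
      -- policies correspond to families of measures on `[0, ν]`
      Function.Bijective (firstLinkLaw : Policy Ω 2 ν → _) ∧
      (∀ π : Policy Ω 2 ν,
        (π ∈ P.feasibleSet ν ↔ firstLinkLaw π ∈ G.uniFeasibleSet ν y) ∧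
        P.cost π = G.uniCost ν y (firstLinkLaw π)) ∧
      -- feasible points of the semidefinite program are the moment vectors of feasible families
      (momentSDP G ν y).feasibleSet = momentVector D '' G.uniFeasibleSet ν y ∧
      (∀ ρ : Ω → ProbabilityMeasure (Set.Icc (0 : ℝ) ν),
        (ρ ∈ G.uniFeasibleSet ν y ↔ momentVector D ρ ∈ (momentSDP G ν y).feasibleSet) ∧
        G.uniCost ν y ρ = (momentSDP G ν y).objective (momentVector D ρ)) ∧
      -- equal optimal values, and correspondence of optimal solutions
      optValue P.cost (P.feasibleSet ν) =
        optValue (momentSDP G ν y).objective (momentSDP G ν y).feasibleSet ∧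
      (∀ π : Policy Ω 2 ν, IsOptimal P.cost (P.feasibleSet ν) π ↔
        IsOptimal (momentSDP G ν y).objective (momentSDP G ν y).feasibleSet
          (momentVector D (firstLinkLaw π))) ∧
      (∀ η, IsOptimal (momentSDP G ν y).objective (momentSDP G ν y).feasibleSet η →
        ∃ π : Policy Ω 2 ν, IsOptimal P.cost (P.feasibleSet ν) π ∧
          momentVector D (firstLinkLaw π) = η) :=
  proposition1_general G ν hν.1 y
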